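/- Let $\mathcal C_2$ be the two-dimensional comb lattice: the graph with vertex set $\mathbb Z^2$ in which $(x,y)$ and $(x',y')$ are adjacent if and only if either $x=x'$ and $|y-y'|=1$, or $y=y'=0$ and $|x-x'|=1$. Let $o=(0,0)$ and let $(X^i_t)_{t\ge 0}$, $i=1,2,\dots$, be independent simple random walks on $\mathcal C_2$, defined on a common probability space and all started at $o$ (at each step a walk moves to a uniformly chosen neighbour of its current position). The internal diffusion limited aggregation (IDLA) clusters are defined recursively by $A_1=\{o\}$ and, for $i\ge 2$, $A_i=A_{i-1}\cup\{X^i_{\sigma^i}\}$, where $\sigma^i=\inf\{t\ge 0: X^i_t\notin A_{i-1}\}$ (if $\sigma^i=\infty$, which has probability $0$, put $A_i=A_{i-1}$). Put $$k=\left(\tfrac32\right)^{2/3},\qquad l=\tfrac12\left(\tfrac32\right)^{1/3},$$ and, for real $r\ge 0$, $$\mathcal B_r=\left\{(x,y)\in\mathbb Z^2:\ \frac{|x|}{k}+\left(\frac{|y|}{l}\right)^{1/2}\le r^{1/3}\right\},$$ with $\mathcal B_r=\emptyset$ for $r<0$. Then for every $\varepsilon>0$, with probability $1$, $$\mathcal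 B_{n(1-\varepsilon)}\subset A_n\quad\text{for all sufficiently large } n.$$ -/

import Mathlib

open MeasureTheory ProbabilityTheory Filter

namespace CombIDLA

/-- The two-dimensional comb lattice: the graph on `ℤ × ℤ` with all vertical edges of the square
lattice, and only those horizontal edges that lie on the `x`-axis. -/
def comb : SimpleGraph (ℤ × ℤ) where
  Adj z w := (z.1 = w.1 ∧ |z.2 - w.2| = 1) ∨ (z.2 = 0 ∧ w.2 = 0 ∧ |z.1 - w.1| = 1)
  symm := ⟨fun z w h => by
    rcases h with ⟨h1, h2⟩ | ⟨h1, h2, h3⟩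
    · exact Or.inl ⟨h1.symm, by rwa [abs_sub_comm]⟩
    · exact Or.inr ⟨h2, h1, by rwa [abs_sub_comm]⟩⟩
  loopless := ⟨fun z h => by simp at h⟩

theorem comb_neighborSet_finite (z : ℤ × ℤ) : (comb.neighborSet z).Finite := by
  refine ((Set.finite_Icc (z.1 - 1) (z.1 + 1)).prod
    (Set.finite_Icc (z.2 - 1) (z.2 + 1))).subset ?_
  rintro w (⟨h1, h2⟩ | ⟨h1, h2, h3⟩)
  · have := abs_le.1 h2.le
    simp only [Set.mem_prod, Set.mem_Icc]
    omega
  · have := abs_le.1 h3.le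
    simp only [Set.mem_prod, Set.mem_Icc]
    omega

noncomputable instance : comb.LocallyFinite := fun z => (comb_neighborSet_finite z).fintype

open Classical in
/-- One-step transition probabilities of the simple random walk on the comb. -/
noncomputable def transProb (z w : ℤ × ℤ) : ℝ :=
  if comb.Adj z w then 1 / (comb.degree z : ℝ) else 0

/-- `Y` is (under `μ`) a simple random walk on the comb started at the origin, expressed through
its finite-dimensional distributions: `Y` follows the path `w 0, …, w n` with probability
`1_{w 0 = o} p(w 0, w 1) ⋯ p(w (n-1), w n)`. -/
structure IsSimpleRandomWalk {Ω : Type*} [MeasurableSpace Ω] (μ : Measure Ω)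
    (Y : ℕ → Ω → ℤ × ℤ) : Prop where
  measurable : ∀ t, Measurable (Y t)
  path_prob : ∀ (n : ℕ) (w : ℕ → ℤ × ℤ),
    μ.real {ω | ∀ t ≤ n, Y t ω = w t} =
      if w 0 = (0, 0) then ∏ t ∈ Finset.range n, transProb (w t) (w (t + 1)) else 0

/-- The position at which the trajectory `y` first leaves the set `A`: the set consisting of this
single point if `y` leaves `A`, and the empty set if it never does. -/
def exitPoint (A : Set (ℤ × ℤ)) (y : ℕ → ℤ × ℤ) : Set (ℤ × ℤ) :=
  {z | ∃ t, y t = z ∧ z ∉ A ∧ ∀ s < t, y s ∈ A}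

/-- The IDLA cluster of `n` particles, where `x i` is the trajectory of the particle released after
`i` particles have already settled. Before any particle is released the cluster is empty. -/
def cluster (x : ℕ → ℕ → ℤ × ℤ) : ℕ → Set (ℤ × ℤ)
  | 0 => ∅
  | n + 1 => cluster x n ∪ exitPoint (cluster x n) (x n)

/-- The first particle settles at its starting point. -/
theorem cluster_one (x : ℕ → ℕ → ℤ × ℤ) (h : x 0 0 = (0, 0)) : cluster x 1 = {(0, 0)} := by
  ext z
  simp only [cluster, exitPoint, Set.empty_union, Set.mem_ofPred_eq, Set.mem_singleton_iff,
    Set.mem_empty_iff_false, not_false_eq_true, true_and]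
  constructor
  · rintro ⟨t, rfl, ht⟩
    rcases Nat.eq_zero_or_pos t with rfl | h0
    · exact h
    · exact (ht 0 h0).elim
  · rintro rfl
    exact ⟨0, h, fun s hs => absurd hs (Nat.not_lt_zero s)⟩

/-- The constant `k = (3/2)^(2/3)`. -/
noncomputable def k : ℝ := (3 / 2 : ℝ) ^ (2 / 3 : ℝ)

/-- The constant `l = (1/2) (3/2)^(1/3)`. -/
noncomputable def l : ℝ := 1 / 2 * (3 / 2 : ℝ) ^ (1 / 3 : ℝ)

/-- The set of all `(x, y)` with `|x| / k + (|y| / l)^(1/2) ≤ r^(1/3)`. It is empty for `r < 0`; the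
condition `0 ≤ r` says so explicitly because `Real.rpow` at a negative base is not the real cube
root. -/
def ball (r : ℝ) : Set (ℤ × ℤ) :=
  {z | 0 ≤ r ∧ |(z.1 : ℝ)| / k + (|(z.2 : ℝ)| / l) ^ (1 / 2 : ℝ) ≤ r ^ (1 / 3 : ℝ)}

end CombIDLA

/-!
Fix a point `z` of the ball and let `H` be the function equal to `1` at `z`, to `0` outside a
slightly smaller, finite copy of the limit shape, and harmonic at the other points: `H v` is the
probability that the walk from `v` hits `z` before it leaves the copy. Give each particle the value
of `H` where its walk first leaves the part of the copy other than `z` already occupied. By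
optional stopping, given the past each of these values has mean at least `H o`. As long as `z` is
not occupied, the particles with a nonzero value settle where their value is read, at distinct
points, so the sum of the values is at most the sum of `H` over the copy.

This is unlikely, because `n * H o` exceeds that sum. Spread mass `n` from the origin over the copy
as in the divisible sandpile, and let `u v` be the mass that `v` sends along each of its edges.
Green's identity bounds the difference below by `u z` times the flow of `H` out of `z`. With `R` of
order `n ^ (1 / 3)`, the mass `u z` is of order `R ^ 4`, by an explicit quadratic profile on each
tooth, and the flow is at least of order `R ^ (-2)`. By the Azuma–Hoeffding inequality `z` is then
missed with probability at most `exp (-c R)`; a union bound over the ball and the Borel–Cantelli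
lemma conclude.
-/

namespace CombIDLA

/-! ### Harmonic functions on locally finite graphs -/

section Graph

variable {V : Type*} (G : SimpleGraph V) [G.LocallyFinite]

/-- The unnormalised graph Laplacian, whose value at `v` is the sum of the increments of the
function along the edges at `v`. -/
def laplacian : (V → ℝ) →ₗ[ℝ] V → ℝ where
  toFun f v := ∑ w ∈ G.neighborFinset v, (f w - f v)
  map_add' f g := by
    ext v
    simp only [Pi.add_apply, ← Finset.sum_add_distrib]
    exact Finset.sum_congr rfl fun w _ => by ring
  map_smul' c f := by
    ext v
    simp only [Pi.smul_apply, smul_eq_mul, RingHom.id_apply, Finset.mul_sum, mul_sub]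

lemma laplacian_apply (f : V → ℝ) (v : V) :
    laplacian G f v = ∑ w ∈ G.neighborFinset v, (f w - f v) := rfl

lemma laplacian_apply' (f : V → ℝ) (v : V) :
    laplacian G f v = ∑ w ∈ G.neighborFinset v, f w - G.degree v * f v := by
  simp [laplacian_apply]

lemma laplacian_sub_one (f : V → ℝ) : laplacian G (f - 1) = laplacian G f := by
  ext v
  simp [laplacian_apply]

variable {G}

lemma nonpos_of_laplacian_nonneg [Infinite V] (hG : G.Preconnected) {D : Finset V} {f : V → ℝ}
    (hD : ∀ v ∈ D, 0 ≤ laplacian G f v) (hf : ∀ v ∉ D, f v ≤ 0) (v : V) : f v ≤ 0 := by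
  by_contra! hv
  have mem_of_pos : ∀ w, 0 < f w → w ∈ D := fun w hw => by_contra fun h => (hf w h).not_gt hw
  obtain ⟨m, -, hm⟩ := D.exists_max_image f ⟨v, mem_of_pos v hv⟩
  have hm0 : 0 < f m := hv.trans_le (hm v (mem_of_pos v hv))
  have hle : ∀ w, f w ≤ f m := fun w => by
    by_cases hw : w ∈ D
    · exact hm w hw
    · exact (hf w hw).trans hm0.le
  have hsub : {w | f w = f m} ⊆ D := fun w (hw : f w = f m) => mem_of_pos w (hw ▸ hm0)
  obtain ⟨x, hx⟩ := Infinite.exists_notMem_finset D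
  obtain ⟨p⟩ := hG m x
  obtain ⟨⟨⟨u, w⟩, huw⟩, -, hu, hw⟩ :=
    p.exists_boundary_dart {w | f w = f m} rfl fun h => hx (hsub h)
  change f u = f m at hu
  refine (hD u (hsub hu)).not_gt ?_
  rw [laplacian_apply, hu]
  exact Finset.sum_neg' (fun i _ => sub_nonpos.2 (hle i))
    ⟨w, (G.mem_neighborFinset u w).2 huw, sub_neg.2 (lt_of_le_of_ne (hle w) hw)⟩

lemma eq_zero_of_laplacian_eq_zero [Infinite V] (hG : G.Preconnected) {D : Finset V} {f : V → ℝ}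
    (hD : ∀ v ∈ D, laplacian G f v = 0) (hf : ∀ v ∉ D, f v = 0) : f = 0 := by
  ext v
  refine le_antisymm ?_ (neg_nonpos.1 ?_)
  · exact nonpos_of_laplacian_nonneg hG (fun v hv => (hD v hv).ge) (fun v hv => (hf v hv).le) v
  · refine nonpos_of_laplacian_nonneg hG (f := -f) (D := D) (fun v hv => ?_) (fun v hv => ?_) v
    · simp [hD v hv]
    · simp [hf v hv]

lemma exists_laplacian_eq [Infinite V] (hG : G.Preconnected) (D : Finset V) (g : V → ℝ) :
    ∃ f : V → ℝ, (∀ v ∉ D, f v = 0) ∧ ∀ v ∈ D, laplacian G f v = g v := by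
  let extend : (D → ℝ) →ₗ[ℝ] V → ℝ := Function.ExtendByZero.linearMap ℝ Subtype.val
  have extend_of_notMem (f : D → ℝ) (v : V) (hv : v ∉ D) : extend f v = 0 :=
    Function.extend_apply' _ _ _ fun ⟨u, hu⟩ => hv (hu ▸ u.2)
  let T : (D → ℝ) →ₗ[ℝ] D → ℝ := LinearMap.funLeft ℝ ℝ Subtype.val ∘ₗ laplacian G ∘ₗ extend
  have hT : Function.Injective T := by
    rw [injective_iff_map_eq_zero]
    intro f hf
    have h0 : extend f = 0 := eq_zero_of_laplacian_eq_zero hG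
      (fun v hv => congr_fun hf ⟨v, hv⟩) (extend_of_notMem f)
    ext v
    rw [← Subtype.val_injective.extend_apply f 0 v]
    exact congr_fun h0 v
  obtain ⟨f, hf⟩ := LinearMap.injective_iff_surjective.1 hT fun v => g v
  exact ⟨extend f, extend_of_notMem f, fun v hv => congr_fun hf ⟨v, hv⟩⟩

lemma sum_neighborFinset_inter [DecidableEq V] [DecidableRel G.Adj] (S : Finset V) (f : V → ℝ)
    (v : V) : ∑ w ∈ G.neighborFinset v ∩ S, f w = ∑ w ∈ S, if G.Adj v w then f w else 0 := by
  rw [← Finset.sum_filter]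
  congr 1
  ext w
  simp [and_comm]

lemma sum_neighborFinset_of_support [DecidableRel G.Adj] {B : Finset V} {f : V → ℝ}
    (hf : ∀ v ∉ B, f v = 0) (v : V) :
    ∑ w ∈ G.neighborFinset v, f w = ∑ w ∈ B, if G.Adj v w then f w else 0 := by
  classical
  rw [← Finset.sum_inter_add_sum_sdiff (G.neighborFinset v) B, sum_neighborFinset_inter,
    Finset.sum_eq_zero fun w hw => hf w (Finset.mem_sdiff.1 hw).2, add_zero]

lemma sum_mul_laplacian_comm {B : Finset V} {f g : V → ℝ} (hf : ∀ v ∉ B, f v = 0)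
    (hg : ∀ v ∉ B, g v = 0) :
    ∑ v ∈ B, f v * laplacian G g v = ∑ v ∈ B, g v * laplacian G f v := by
  classical
  have expand {f g : V → ℝ} (hg : ∀ v ∉ B, g v = 0) :
      ∑ v ∈ B, f v * laplacian G g v = ∑ v ∈ B, ∑ w ∈ B, (if G.Adj v w then f v * g w else 0) -
        ∑ v ∈ B, G.degree v * (f v * g v) := by
    rw [← Finset.sum_sub_distrib]
    refine Finset.sum_congr rfl fun v _ => ?_
    rw [laplacian_apply', sum_neighborFinset_of_support hg, mul_sub, Finset.mul_sum]
    simp only [mul_ite, mul_zero]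
    ring
  rw [expand hg, expand hf, Finset.sum_comm]
  simp only [G.adj_comm, mul_comm]

lemma sum_laplacian_eq_sum_boundary [DecidableEq V] (S : Finset V) (f : V → ℝ) :
    ∑ u ∈ S, laplacian G f u = ∑ u ∈ S, ∑ w ∈ G.neighborFinset u \ S, (f w - f u) := by
  classical
  have internal : ∑ u ∈ S, ∑ w ∈ G.neighborFinset u ∩ S, (f w - f u) = 0 := by
    refine self_eq_neg.1 ?_
    simp only [sum_neighborFinset_inter]
    conv_lhs => rw [Finset.sum_comm]
    simp only [← Finset.sum_neg_distrib, G.adj_comm, neg_ite, neg_sub, neg_zero]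
  simp only [laplacian_apply]
  rw [← zero_add (∑ u ∈ S, ∑ w ∈ _ \ S, _), ← internal, ← Finset.sum_add_distrib]
  exact Finset.sum_congr rfl fun u _ => (Finset.sum_inter_add_sum_sdiff _ _ _).symm

variable (G) in
/-- The characteristic properties of the probability `H v` that the simple random walk started
at `v` hits `z` before it leaves `B`. -/
structure IsHittingFunction (B : Finset V) (z : V) (H : V → ℝ) : Prop where
  apply_self : H z = 1
  apply_of_notMem : ∀ v ∉ B, H v = 0
  laplacian_eq_zero : ∀ v ∈ B, v ≠ z → laplacian G H v = 0

lemma exists_isHittingFunction [Infinite V] (hG : G.Preconnected) {B : Finset V} {z : V}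
    (hz : z ∈ B) : ∃ H, IsHittingFunction G B z H := by
  classical
  obtain ⟨f, hf0, hf⟩ := exists_laplacian_eq hG (B.erase z) (-laplacian G (Pi.single z 1))
  refine ⟨f + Pi.single z 1, ?_, fun v hv => ?_, fun v hv hvz => ?_⟩
  · simp [hf0 z]
  · have hvz : v ≠ z := fun h => hv (h ▸ hz)
    simp [hf0 v (fun h => hv (Finset.mem_of_mem_erase h)), hvz]
  · simp [hf v (Finset.mem_erase.2 ⟨hvz, hv⟩)]

namespace IsHittingFunction

variable {B : Finset V} {z : V} {H : V → ℝ}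

lemma mem (hH : IsHittingFunction G B z H) : z ∈ B :=
  by_contra fun hz => one_ne_zero (hH.apply_self.symm.trans (hH.apply_of_notMem z hz))

lemma nonneg [Infinite V] (hG : G.Preconnected) (hH : IsHittingFunction G B z H) (v : V) :
    0 ≤ H v := by
  classical
  refine neg_nonpos.1 (nonpos_of_laplacian_nonneg hG (D := B.erase z) (f := -H) ?_ ?_ v)
  · intro v hv
    simp [hH.laplacian_eq_zero v (Finset.mem_of_mem_erase hv) (Finset.ne_of_mem_erase hv)]
  · intro v hv
    obtain rfl | hvz := eq_or_ne v z
    · simp [hH.apply_self]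
    · simp [hH.apply_of_notMem v fun h => hv (Finset.mem_erase.2 ⟨hvz, h⟩)]

lemma le_one [Infinite V] (hG : G.Preconnected) (hH : IsHittingFunction G B z H) (v : V) :
    H v ≤ 1 := by
  classical
  refine sub_nonpos.1 (nonpos_of_laplacian_nonneg hG (D := B.erase z) (f := H - 1) ?_ ?_ v)
  · intro v hv
    rw [laplacian_sub_one,
      hH.laplacian_eq_zero v (Finset.mem_of_mem_erase hv) (Finset.ne_of_mem_erase hv)]
  · intro v hv
    obtain rfl | hvz := eq_or_ne v z
    · simp [hH.apply_self]
    · simp [hH.apply_of_notMem v fun h => hv (Finset.mem_erase.2 ⟨hvz, h⟩)]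

lemma laplacian_self_nonpos [Infinite V] (hG : G.Preconnected) (hH : IsHittingFunction G B z H) :
    laplacian G H z ≤ 0 := by
  rw [laplacian_apply, hH.apply_self]
  exact Finset.sum_nonpos fun w _ => sub_nonpos.2 (hH.le_one hG w)

/-- The flow across the boundary of a superlevel set of `H` consists of nonnegative terms with
sum `-laplacian G H z`, so no single edge carries more than that. -/
lemma sub_le [Infinite V] (hG : G.Preconnected) (hH : IsHittingFunction G B z H) {v w : V}
    (hvw : G.Adj v w) : H v - H w ≤ -laplacian G H z := by
  classical
  obtain hle | hlt := le_or_gt (H v) (H w)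
  · linarith [hH.laplacian_self_nonpos hG]
  let S := B.filter fun u => H v ≤ H u
  have hv : v ∈ S := by
    refine Finset.mem_filter.2 ⟨by_contra fun h => ?_, le_rfl⟩
    linarith [hH.apply_of_notMem v h, hH.nonneg hG w]
  have hw : w ∈ G.neighborFinset v \ S := by simp [S, hvw, hlt]
  have hflow : ∑ u ∈ S, ∑ x ∈ G.neighborFinset u \ S, (H u - H x) = -laplacian G H z := by
    have hz : z ∈ S := Finset.mem_filter.2 ⟨hH.mem, hH.apply_self ▸ hH.le_one hG v⟩
    rw [← Finset.sum_eq_single_of_mem z hz fun u hu =>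
      hH.laplacian_eq_zero u (Finset.mem_filter.1 hu).1, sum_laplacian_eq_sum_boundary]
    simp only [← Finset.sum_neg_distrib, neg_sub]
  have hnonneg : ∀ u ∈ S, ∀ x ∈ G.neighborFinset u \ S, 0 ≤ H u - H x := by
    intro u hu x hx
    refine sub_nonneg.2 (le_trans ?_ (Finset.mem_filter.1 hu).2)
    by_cases hxB : x ∈ B
    · exact le_of_not_ge fun h => (Finset.mem_sdiff.1 hx).2 (Finset.mem_filter.2 ⟨hxB, h⟩)
    · exact (hH.apply_of_notMem x hxB).trans_le (hH.nonneg hG v)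
  calc H v - H w ≤ ∑ x ∈ G.neighborFinset v \ S, (H v - H x) :=
        Finset.single_le_sum (f := fun x => H v - H x) (hnonneg v hv) hw
    _ ≤ ∑ u ∈ S, ∑ x ∈ G.neighborFinset u \ S, (H u - H x) :=
        Finset.single_le_sum (f := fun u => ∑ x ∈ G.neighborFinset u \ S, (H u - H x))
          (fun u hu => Finset.sum_nonneg (hnonneg u hu)) hv
    _ = -laplacian G H z := hflow

lemma sub_le_length_mul [Infinite V] (hG : G.Preconnected) (hH : IsHittingFunction G B z H)
    {v w : V} (p : G.Walk v w) : H v - H w ≤ p.length * -laplacian G H z := by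
  induction p with
  | nil => simp
  | cons hadj p ih =>
    rw [SimpleGraph.Walk.length_cons]
    push_cast
    linarith [hH.sub_le hG hadj]

end IsHittingFunction

end Graph

/-! ### The comb -/

lemma comb_adj_vertical (x y : ℤ) : comb.Adj (x, y) (x, y + 1) := Or.inl (by simp)

lemma comb_adj_horizontal (x : ℤ) : comb.Adj (x, 0) (x + 1, 0) := Or.inr (by simp)

lemma degree_comb_pos (v : ℤ × ℤ) : 0 < comb.degree v :=
  (comb.degree_pos_iff_exists_adj v).2 ⟨_, comb_adj_vertical v.1 v.2⟩

lemma comb_preconnected : comb.Preconnected := by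
  have vertical (x y : ℤ) : comb.Reachable (x, 0) (x, y) := by
    induction y using Int.induction_on with
    | zero => rfl
    | succ n ih => exact ih.trans (comb_adj_vertical x n).reachable
    | pred n ih =>
      exact ih.trans (by simpa using (comb_adj_vertical x (-n - 1)).symm.reachable)
  have horizontal (x : ℤ) : comb.Reachable (0, 0) (x, 0) := by
    induction x using Int.induction_on with
    | zero => rfl
    | succ n ih => exact ih.trans (comb_adj_horizontal n).reachable
    | pred n ih => exact ih.trans (by simpa using (comb_adj_horizontal (-n - 1)).symm.reachable)
  have origin (v : ℤ × ℤ) : comb.Reachable (0, 0) v := (horizontal v.1).trans (vertical v.1 v.2)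
  exact fun v w => (origin v).symm.trans (origin w)

lemma exists_vertical_walk (x y : ℤ) (d : ℕ) : ∃ p : comb.Walk (x, y) (x, y + d), p.length = d := by
  induction d with
  | zero => exact ⟨SimpleGraph.Walk.nil.copy rfl (by simp), by simp⟩
  | succ d ih =>
    obtain ⟨p, hp⟩ := ih
    refine ⟨(p.concat (comb_adj_vertical x (y + d))).copy rfl (by push_cast; ring_nf), ?_⟩
    simp [hp]

lemma neighborFinset_comb (x y : ℤ) :
    comb.neighborFinset (x, y) =
      if y = 0 then {(x, y + 1), (x, y - 1), (x + 1, y), (x - 1, y)}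
      else {(x, y + 1), (x, y - 1)} := by
  ext ⟨a, b⟩
  rw [SimpleGraph.mem_neighborFinset]
  split_ifs <;>
    simp only [comb, Finset.mem_insert, Finset.mem_singleton, Prod.mk.injEq,
      abs_eq (zero_le_one' ℤ)] <;> omega

lemma laplacian_comb (f : ℤ × ℤ → ℝ) (x y : ℤ) :
    laplacian comb f (x, y) = f (x, y + 1) + f (x, y - 1) - 2 * f (x, y) +
      if y = 0 then f (x + 1, y) + f (x - 1, y) - 2 * f (x, y) else 0 := by
  rw [laplacian_apply, neighborFinset_comb]
  split_ifs
  · rw [Finset.sum_insert, Finset.sum_insert, Finset.sum_insert, Finset.sum_singleton]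
    · ring
    all_goals simp only [Finset.mem_insert, Finset.mem_singleton, Prod.mk.injEq]; omega
  · rw [Finset.sum_insert, Finset.sum_singleton]
    · ring
    all_goals simp only [Finset.mem_singleton, Prod.mk.injEq]; omega

/-! ### The walk up to its exit from a finite set -/

lemma sum_transProb_mul {B : Finset (ℤ × ℤ)} {f : ℤ × ℤ → ℝ} (hf : ∀ w ∉ B, f w = 0) (v : ℤ × ℤ) :
    ∑ w ∈ B, transProb v w * f w = f v + laplacian comb f v / comb.degree v := by
  classical
  have hd : (comb.degree v : ℝ) ≠ 0 := by exact_mod_cast (degree_comb_pos v).ne'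
  have hterm (w : ℤ × ℤ) :
      transProb v w * f w = (if comb.Adj v w then f w else 0) / comb.degree v := by
    unfold transProb
    split_ifs <;> ring
  simp only [hterm, ← Finset.sum_div, ← sum_neighborFinset_of_support hf, laplacian_apply']
  field_simp
  ring

/-- The event that `Y` is in `D` at all times before `m` and then agrees with the path `q` from
time `m` to time `n`. Increasing `m` interpolates between the events whose probabilities define a
random walk and those describing its exit from `D`. -/
def stayThenFollow {Ω S : Type*} (Y : ℕ → Ω → S) (D : Set S) (m n : ℕ) (q : ℕ → S) : Set Ω :=
  {ω | (∀ s < m, Y s ω ∈ D) ∧ ∀ s ≤ n, m ≤ s → Y s ω = q s}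

lemma stayThenFollow_self {Ω S : Type*} (Y : ℕ → Ω → S) (D : Set S) (n : ℕ) (q : ℕ → S) :
    stayThenFollow Y D n n q = {ω | (∀ s < n, Y s ω ∈ D) ∧ Y n ω = q n} := by
  ext ω
  exact and_congr_right fun _ => ⟨fun h => h n le_rfl le_rfl, fun h s h1 h2 => h1.antisymm h2 ▸ h⟩

lemma measurableSet_stayThenFollow {Ω S : Type*} [MeasurableSpace Ω] [MeasurableSpace S]
    [MeasurableSingletonClass S] [Countable S] {Y : ℕ → Ω → S} (hY : ∀ t, Measurable (Y t))
    (D : Set S) (m n : ℕ) (q : ℕ → S) : MeasurableSet (stayThenFollow Y D m n q) := by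
  simp only [stayThenFollow, Set.ofPred_and, Set.ofPred_forall]
  refine MeasurableSet.inter ?_ ?_
  · exact .iInter fun s => .iInter fun _ => hY s D.to_countable.measurableSet
  · exact .iInter fun s => .iInter fun _ => .iInter fun _ => hY s (measurableSet_singleton _)

lemma measureReal_stayThenFollow_succ {Ω S : Type*} [MeasurableSpace Ω] [MeasurableSpace S]
    [MeasurableSingletonClass S] [Countable S] {μ : Measure Ω} [IsFiniteMeasure μ] {Y : ℕ → Ω → S}
    (hY : ∀ t, Measurable (Y t)) (D : Finset S) {m n : ℕ} (hmn : m ≤ n)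
    (q : ℕ → S) :
    μ.real (stayThenFollow Y D (m + 1) n q) =
      ∑ v ∈ D, μ.real (stayThenFollow Y D m n (Function.update q m v)) := by
  have hunion : stayThenFollow Y D (m + 1) n q =
      ⋃ v ∈ D, stayThenFollow Y D m n (Function.update q m v) := by
    ext ω
    simp only [stayThenFollow, Set.mem_iUnion, exists_prop, Set.mem_ofPred_eq, Finset.mem_coe]
    constructor
    · rintro ⟨hstay, hfollow⟩
      refine ⟨Y m ω, hstay m m.lt_succ_self, fun s hs => hstay s (hs.trans m.lt_succ_self), ?_⟩
      intro s hsn hms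
      obtain rfl | hlt := hms.eq_or_lt
      · simp
      · rw [Function.update_of_ne hlt.ne', hfollow s hsn hlt]
    · rintro ⟨v, hv, hstay, hfollow⟩
      refine ⟨fun s hs => ?_, fun s hsn hms => ?_⟩
      · obtain hlt | rfl := (Nat.lt_succ_iff.1 hs).lt_or_eq
        · exact hstay s hlt
        · simpa [hfollow s hmn le_rfl] using hv
      · rw [hfollow s hsn (by omega), Function.update_of_ne (by omega)]
  rw [hunion, measureReal_biUnion_finset]
  · intro v _ v' _ hne
    refine Set.disjoint_left.2 fun ω h h' => hne ?_
    simpa using (h.2 m hmn le_rfl).symm.trans (h'.2 m hmn le_rfl)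
  · exact fun v _ => measurableSet_stayThenFollow hY _ _ _ _

/-- The sub-probability mass function of the position at time `t` of the process `Y` killed after
its first step out of `D`. -/
noncomputable def killed {Ω S : Type*} [MeasurableSpace Ω] (μ : Measure Ω) (Y : ℕ → Ω → S)
    (D : Finset S) (t : ℕ) (w : S) : ℝ :=
  μ.real {ω | (∀ s < t, Y s ω ∈ D) ∧ Y t ω = w}

lemma killed_nonneg {Ω S : Type*} [MeasurableSpace Ω] (μ : Measure Ω) (Y : ℕ → Ω → S)
    (D : Finset S) (t : ℕ) (w : S) : 0 ≤ killed μ Y D t w :=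
  measureReal_nonneg

lemma killed_eq_stayThenFollow {Ω S : Type*} [MeasurableSpace Ω] (μ : Measure Ω) (Y : ℕ → Ω → S)
    (D : Finset S) (t : ℕ) (q : ℕ → S) :
    killed μ Y D t (q t) = μ.real (stayThenFollow Y D t t q) := by
  rw [stayThenFollow_self]
  rfl

lemma hasSum_measureReal_iUnion {Ω ι : Type*} [MeasurableSpace Ω] [Countable ι] {μ : Measure Ω}
    [IsFiniteMeasure μ] {E : ι → Set Ω} (hd : Pairwise (Function.onFun Disjoint E))
    (hE : ∀ i, MeasurableSet (E i)) : HasSum (fun i => μ.real (E i)) (μ.real (⋃ i, E i)) := by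
  have h := measure_iUnion (μ := μ) hd hE
  rw [measureReal_def, h, ENNReal.tsum_toReal_eq fun i => measure_ne_top μ _]
  exact ENNReal.hasSum_toReal (h ▸ measure_ne_top μ _)

lemma hasSum_killed {Ω : Type*} [MeasurableSpace Ω] {μ : Measure Ω} [IsFiniteMeasure μ]
    {Y : ℕ → Ω → ℤ × ℤ} (hY : ∀ t, Measurable (Y t)) (D : Finset (ℤ × ℤ)) {w : ℤ × ℤ}
    (hw : w ∉ D) :
    HasSum (fun t => killed μ Y D t w) (μ.real {ω | w ∈ exitPoint D (fun t => Y t ω)}) := by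
  have hexit : {ω | w ∈ exitPoint D (fun t => Y t ω)} = ⋃ t, stayThenFollow Y D t t fun _ => w := by
    ext ω
    simp [exitPoint, stayThenFollow_self, hw, and_comm]
  simp only [hexit, killed_eq_stayThenFollow μ Y D _ fun _ => w]
  refine hasSum_measureReal_iUnion (fun s t hst => ?_) fun t =>
    measurableSet_stayThenFollow hY _ _ _ _
  simp only [Function.onFun, stayThenFollow_self]
  refine Set.disjoint_left.2 fun ω h h' => hw ?_
  obtain hlt | hgt := hst.lt_or_gt
  · exact h.2 ▸ h'.1 s hlt
  · exact h'.2 ▸ h.1 t hgt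

namespace IsSimpleRandomWalk

variable {Ω : Type*} [MeasurableSpace Ω] {μ : Measure Ω} {Y : ℕ → Ω → ℤ × ℤ}

lemma killed_zero (hY : IsSimpleRandomWalk μ Y) (D : Finset (ℤ × ℤ)) (w : ℤ × ℤ) :
    killed μ Y D 0 w = if w = (0, 0) then 1 else 0 := by
  simpa [killed] using hY.path_prob 0 fun _ => w

lemma sum_killed_zero_mul (hY : IsSimpleRandomWalk μ Y) (D : Finset (ℤ × ℤ))
    {B : Finset (ℤ × ℤ)} {f : ℤ × ℤ → ℝ} (hf : ∀ w ∉ B, f w = 0) :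
    ∑ w ∈ B, killed μ Y D 0 w * f w = f (0, 0) := by
  simp only [hY.killed_zero, ite_mul, one_mul, zero_mul, Finset.sum_ite_eq']
  split_ifs with h
  · rfl
  · exact (hf _ h).symm

variable [IsFiniteMeasure μ]

lemma measureReal_stayThenFollow (hY : IsSimpleRandomWalk μ Y) (D : Finset (ℤ × ℤ)) {m n : ℕ}
    (hmn : m ≤ n) (q : ℕ → ℤ × ℤ) :
    μ.real (stayThenFollow Y D m (n + 1) q) =
      μ.real (stayThenFollow Y D m n q) * transProb (q n) (q (n + 1)) := by
  induction m generalizing q with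
  | zero =>
    have hpath (n : ℕ) : stayThenFollow Y D 0 n q = {ω | ∀ t ≤ n, Y t ω = q t} := by
      simp [stayThenFollow]
    rw [hpath, hpath, hY.path_prob, hY.path_prob, Finset.prod_range_succ, ite_mul, zero_mul]
  | succ m ih =>
    rw [measureReal_stayThenFollow_succ hY.measurable D (by omega),
      measureReal_stayThenFollow_succ hY.measurable D (by omega), Finset.sum_mul]
    refine Finset.sum_congr rfl fun v _ => ?_
    rw [ih (by omega), Function.update_of_ne (by omega), Function.update_of_ne (by omega)]

lemma killed_succ (hY : IsSimpleRandomWalk μ Y) (D : Finset (ℤ × ℤ)) (t : ℕ) (w : ℤ × ℤ) :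
    killed μ Y D (t + 1) w = ∑ v ∈ D, killed μ Y D t v * transProb v w := by
  rw [killed_eq_stayThenFollow μ Y D (t + 1) fun _ => w,
    measureReal_stayThenFollow_succ hY.measurable D t.le_succ]
  refine Finset.sum_congr rfl fun v _ => ?_
  rw [hY.measureReal_stayThenFollow D le_rfl, ← killed_eq_stayThenFollow, Function.update_self,
    Function.update_of_ne t.succ_ne_self]

lemma sum_killed_succ_mul (hY : IsSimpleRandomWalk μ Y) (D : Finset (ℤ × ℤ))
    {B : Finset (ℤ × ℤ)} {f : ℤ × ℤ → ℝ} (hf : ∀ w ∉ B, f w = 0) (t : ℕ) :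
    ∑ w ∈ B, killed μ Y D (t + 1) w * f w =
      ∑ v ∈ D, killed μ Y D t v * (f v + laplacian comb f v / comb.degree v) := by
  simp only [hY.killed_succ, Finset.sum_mul, ← sum_transProb_mul hf, Finset.mul_sum]
  rw [Finset.sum_comm]
  simp only [mul_assoc]

lemma summable_sum_killed (hY : IsSimpleRandomWalk μ Y) (D : Finset (ℤ × ℤ)) :
    Summable fun t => ∑ w ∈ D, killed μ Y D t w := by
  -- `g` is the expected exit time, so its mean along the killed walk drops by the mass alive
  obtain ⟨g, hg0, hg⟩ := exists_laplacian_eq comb_preconnected D fun v => -(comb.degree v : ℝ)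
  have hgnonneg (v : ℤ × ℤ) : 0 ≤ g v := by
    refine neg_nonpos.1 (nonpos_of_laplacian_nonneg comb_preconnected (D := D) (f := -g)
      (fun v hv => ?_) (fun v hv => by simp [hg0 v hv]) v)
    simp [hg v hv]
  let a (t : ℕ) : ℝ := ∑ w ∈ D, killed μ Y D t w * g w
  have hdrop (t : ℕ) : ∑ w ∈ D, killed μ Y D t w = a t - a (t + 1) := by
    simp only [a]
    rw [hY.sum_killed_succ_mul D hg0, ← Finset.sum_sub_distrib]
    refine Finset.sum_congr rfl fun v hv => ?_
    have hd : (comb.degree v : ℝ) ≠ 0 := by exact_mod_cast (degree_comb_pos v).ne'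
    rw [hg v hv, neg_div, div_self hd]
    ring
  refine summable_of_sum_range_le (c := a 0)
    (fun t => Finset.sum_nonneg fun w _ => killed_nonneg μ Y D t w) fun n => ?_
  simp only [hdrop, Finset.sum_range_sub']
  exact sub_le_self _ (Finset.sum_nonneg fun w _ => mul_nonneg (killed_nonneg μ Y D n w)
    (hgnonneg w))

lemma summable_killed (hY : IsSimpleRandomWalk μ Y) (D : Finset (ℤ × ℤ)) (w : ℤ × ℤ) :
    Summable fun t => killed μ Y D t w := by
  by_cases hw : w ∈ D
  · exact (hY.summable_sum_killed D).of_nonneg_of_le (fun t => killed_nonneg μ Y D t w) fun t =>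
      Finset.single_le_sum (fun v _ => killed_nonneg μ Y D t v) hw
  · exact (hasSum_killed hY.measurable D hw).summable

lemma le_sum_exitPoint (hY : IsSimpleRandomWalk μ Y) {D B : Finset (ℤ × ℤ)} (hDB : D ⊆ B)
    {f : ℤ × ℤ → ℝ} (hfB : ∀ w ∉ B, f w = 0) (hfD : ∀ v ∈ D, 0 ≤ laplacian comb f v) :
    f (0, 0) ≤ ∑ w ∈ B \ D, μ.real {ω | w ∈ exitPoint D (fun t => Y t ω)} * f w := by
  let K (w : ℤ × ℤ) : ℝ := ∑' t, killed μ Y D t w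
  have hsummable (w : ℤ × ℤ) (c : ℝ) : Summable fun t => killed μ Y D t w * c :=
    (hY.summable_killed D w).mul_right c
  have hstep : ∑ w ∈ B, K w * f w =
      f (0, 0) + ∑ v ∈ D, K v * (f v + laplacian comb f v / comb.degree v) := by
    simp only [K, ← tsum_mul_right]
    rw [← Summable.tsum_finsetSum fun w _ => hsummable w _,
      ← Summable.tsum_finsetSum fun w _ => hsummable w _,
      (summable_sum fun w _ => hsummable w _).tsum_eq_zero_add, hY.sum_killed_zero_mul D hfB]
    simp only [hY.sum_killed_succ_mul D hfB]
  have hgain : ∑ v ∈ D, K v * f v ≤ ∑ v ∈ D, K v * (f v + laplacian comb f v / comb.degree v) := by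
    refine Finset.sum_le_sum fun v hv => mul_le_mul_of_nonneg_left ?_
      (tsum_nonneg fun t => killed_nonneg μ Y D t v)
    exact le_add_of_nonneg_right (div_nonneg (hfD v hv) (Nat.cast_nonneg _))
  have hexit : ∑ w ∈ B \ D, μ.real {ω | w ∈ exitPoint D (fun t => Y t ω)} * f w =
      ∑ w ∈ B \ D, K w * f w := Finset.sum_congr rfl fun w hw => by
    rw [← (hasSum_killed hY.measurable D (Finset.mem_sdiff.1 hw).2).tsum_eq]
  rw [hexit]
  linarith [Finset.sum_sdiff (f := fun w => K w * f w) hDB]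

end IsSimpleRandomWalk

lemma subsingleton_exitPoint (A : Set (ℤ × ℤ)) (y : ℕ → ℤ × ℤ) : (exitPoint A y).Subsingleton := by
  rintro _ ⟨s, rfl, hs, hs'⟩ _ ⟨t, rfl, ht, ht'⟩
  obtain hlt | rfl | hgt := lt_trichotomy s t
  · exact absurd (ht' s hlt) hs
  · rfl
  · exact absurd (hs' t hgt) ht

lemma measurableSet_mem_exitPoint {Ω : Type*} [MeasurableSpace Ω] {A : Ω → Set (ℤ × ℤ)}
    (hA : ∀ v, MeasurableSet {ω | v ∈ A ω}) {y : Ω → ℕ → ℤ × ℤ} (hy : Measurable y) (v : ℤ × ℤ) :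
    MeasurableSet {ω | v ∈ exitPoint (A ω) (y ω)} := by
  have hyt (t : ℕ) (w : ℤ × ℤ) : MeasurableSet {ω | y ω t = w} :=
    (measurable_pi_apply t).comp hy (measurableSet_singleton w)
  have hstay (t : ℕ) : MeasurableSet {ω | y ω t ∈ A ω} := by
    have : {ω | y ω t ∈ A ω} = ⋃ w, {ω | y ω t = w} ∩ {ω | w ∈ A ω} := by
      ext ω
      simp
    exact this ▸ .iUnion fun w => (hyt t w).inter (hA w)
  have : {ω | v ∈ exitPoint (A ω) (y ω)} =
      ⋃ t, {ω | y ω t = v} ∩ ({ω | v ∈ A ω}ᶜ ∩ ⋂ s < t, {ω | y ω s ∈ A ω}) := by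
    ext ω
    simp [exitPoint]
  exact this ▸ .iUnion fun t => (hyt t v).inter
    ((hA v).compl.inter (.iInter fun s => .iInter fun _ => hstay s))

/-- The value of `H` at the point where the trajectory `y` leaves `D`, and `0` if that point is
not in `B` or does not exist. -/
noncomputable def exitValue (B : Finset (ℤ × ℤ)) (H : ℤ × ℤ → ℝ) (D : Set (ℤ × ℤ))
    (y : ℕ → ℤ × ℤ) : ℝ :=
  ∑ w ∈ B, (exitPoint D y).indicator H w

section exitValue

variable {B : Finset (ℤ × ℤ)} {H : ℤ × ℤ → ℝ}

lemma exitValue_nonneg (hH : ∀ w, 0 ≤ H w) (D : Set (ℤ × ℤ)) (y : ℕ → ℤ × ℤ) :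
    0 ≤ exitValue B H D y :=
  Finset.sum_nonneg fun w _ => Set.indicator_nonneg (fun v _ => hH v) w

lemma exitValue_le_one (hH : ∀ w, H w ≤ 1) (D : Set (ℤ × ℤ)) (y : ℕ → ℤ × ℤ) :
    exitValue B H D y ≤ 1 := by
  obtain hempty | ⟨w, hw⟩ := (subsingleton_exitPoint D y).eq_empty_or_singleton
  · simp [exitValue, hempty]
  · classical
    simp only [exitValue, hw, Set.indicator_apply, Set.mem_singleton_iff, Finset.sum_ite_eq']
    split_ifs
    exacts [hH w, zero_le_one]

lemma measurable_exitValue {Ω : Type*} [MeasurableSpace Ω] {A : Ω → Set (ℤ × ℤ)}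
    (hA : ∀ v, MeasurableSet {ω | v ∈ A ω}) {y : Ω → ℕ → ℤ × ℤ} (hy : Measurable y) :
    Measurable fun ω => exitValue B H (A ω) (y ω) := by
  classical
  simp only [exitValue, Set.indicator_apply]
  exact Finset.measurable_fun_sum _ fun w _ =>
    Measurable.ite (measurableSet_mem_exitPoint hA hy w) measurable_const measurable_const

lemma IsSimpleRandomWalk.le_integral_exitValue {Ω : Type*} [MeasurableSpace Ω] {μ : Measure Ω}
    [IsFiniteMeasure μ] {y : Ω → ℕ → ℤ × ℤ} (hY : IsSimpleRandomWalk μ fun t ω => y ω t)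
    {D : Finset (ℤ × ℤ)} (hDB : D ⊆ B) (hH : ∀ w, 0 ≤ H w) (hHB : ∀ w ∉ B, H w = 0)
    (hHD : ∀ v ∈ D, 0 ≤ laplacian comb H v) : H (0, 0) ≤ ∫ ω, exitValue B H D (y ω) ∂μ := by
  have hexit (w : ℤ × ℤ) : MeasurableSet {ω | w ∈ exitPoint D (y ω)} :=
    measurableSet_mem_exitPoint (fun _ => .const _) (measurable_pi_lambda y hY.measurable) w
  have hindicator (w : ℤ × ℤ) (ω : Ω) : (exitPoint D (y ω)).indicator H w =
      {ω | w ∈ exitPoint D (y ω)}.indicator (fun _ => H w) ω := rfl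
  simp only [exitValue, hindicator]
  rw [integral_finsetSum _ fun w _ => (integrable_const (H w)).indicator (hexit w)]
  simp only [integral_indicator_const _ (hexit _), smul_eq_mul]
  exact (hY.le_sum_exitPoint hDB hHB hHD).trans <|
    Finset.sum_le_sum_of_subset_of_nonneg Finset.sdiff_subset
      fun w _ _ => mul_nonneg measureReal_nonneg (hH w)

end exitValue

/-! ### Concentration for functions of independent variables -/

section Probability

open scoped ENNReal

variable {Ω E : Type*} [MeasurableSpace E]

/-- The σ-algebra generated by `X 0, …, X (n - 1)`. -/
@[reducible]
def past (X : ℕ → Ω → E) (n : ℕ) : MeasurableSpace Ω :=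
  ⨆ i ∈ Set.Iio n, MeasurableSpace.comap (X i) inferInstance

lemma past_mono (X : ℕ → Ω → E) : Monotone (past X) :=
  fun _ _ h => biSup_mono fun _ hi => lt_of_lt_of_le hi h

lemma measurable_past (X : ℕ → Ω → E) {i n : ℕ} (h : i < n) : Measurable[past X n] (X i) :=
  Measurable.mono (comap_measurable _)
    (le_biSup (fun i => MeasurableSpace.comap (X i) inferInstance) (show i ∈ Set.Iio n from h))
    le_rfl

lemma measurable_past_eval {X : ℕ → Ω → E} {F : Type*} [MeasurableSpace F] {j n : ℕ} (h : j < n)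
    {φ : Ω → E → F} (hφ : Measurable[(past X j).prod inferInstance] (Function.uncurry φ)) :
    Measurable[past X n] fun ω => φ ω (X j ω) :=
  hφ.comp <| @Measurable.prodMk _ (past X n) _ _ (past X j) _ _ _
    (measurable_id.mono (past_mono X h.le) le_rfl) (measurable_past X h)

variable [MeasurableSpace Ω] {μ : Measure Ω}

lemma past_le {X : ℕ → Ω → E} (hX : ∀ i, Measurable (X i)) (n : ℕ) :
    past X n ≤ (inferInstance : MeasurableSpace Ω) :=
  iSup₂_le fun i _ => (hX i).comap_le

lemma indep_past {X : ℕ → Ω → E} (hX : ∀ i, Measurable (X i)) (hindep : iIndepFun X μ) (n : ℕ) :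
    Indep (past X n) (MeasurableSpace.comap (X n) inferInstance) μ := by
  have := indep_iSup_of_disjoint (fun i => (hX i).comap_le) hindep.iIndep
    (S := Set.Iio n) (T := {n}) (by simp)
  simpa only [past, Set.mem_singleton_iff, iSup_iSup_eq_left] using this

lemma lintegral_eq_lintegral_lintegral_of_indepFun [IsFiniteMeasure μ] {F : Type*}
    [MeasurableSpace F] {U : Ω → F} {X : Ω → E} (hU : Measurable U) (hX : Measurable X)
    (hindep : IndepFun U X μ) {φ : F → E → ℝ≥0∞} (hφ : Measurable (Function.uncurry φ)) :
    ∫⁻ ω, φ (U ω) (X ω) ∂μ = ∫⁻ ω, ∫⁻ ω', φ (U ω) (X ω') ∂μ ∂μ := by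
  calc ∫⁻ ω, φ (U ω) (X ω) ∂μ
      = ∫⁻ q, Function.uncurry φ q ∂μ.map (fun ω => (U ω, X ω)) :=
        (lintegral_map hφ (hU.prodMk hX)).symm
    _ = ∫⁻ u, ∫⁻ e, φ u e ∂μ.map X ∂μ.map U := by
        rw [(indepFun_iff_map_prod_eq_prod_map_map hU.aemeasurable hX.aemeasurable).1 hindep]
        exact lintegral_prod _ hφ.aemeasurable
    _ = ∫⁻ ω, ∫⁻ e, φ (U ω) e ∂μ.map X ∂μ :=
        lintegral_map hφ.lintegral_prod_right' hU
    _ = ∫⁻ ω, ∫⁻ ω', φ (U ω) (X ω') ∂μ ∂μ :=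
        lintegral_congr fun ω => lintegral_map hφ.of_uncurry_left hX

lemma lintegral_past_eq [IsFiniteMeasure μ] {X : ℕ → Ω → E} (hX : ∀ i, Measurable (X i))
    (hindep : iIndepFun X μ) {n : ℕ} {φ : Ω → E → ℝ≥0∞}
    (hφ : Measurable[(past X n).prod inferInstance] (Function.uncurry φ)) :
    ∫⁻ ω, φ ω (X n ω) ∂μ = ∫⁻ ω, ∫⁻ ω', φ ω (X n ω') ∂μ ∂μ :=
  @lintegral_eq_lintegral_lintegral_of_indepFun Ω E _ _ μ _ Ω (past X n) id (X n)
    (measurable_id.mono (past_le hX n) le_rfl) (hX n)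
    ((@IndepFun_iff_Indep Ω Ω E _ (past X n) _ id (X n) μ).2
      (MeasurableSpace.comap_id.symm ▸ indep_past hX hindep n)) φ hφ

lemma lintegral_prod_le_pow [IsProbabilityMeasure μ] {X : ℕ → Ω → E} (hX : ∀ i, Measurable (X i))
    (hindep : iIndepFun X μ) {φ : ℕ → Ω → E → ℝ≥0∞}
    (hφ : ∀ j, Measurable[(past X j).prod inferInstance] (Function.uncurry (φ j))) {c : ℝ≥0∞}
    (hc : ∀ j ω, ∫⁻ ω', φ j ω (X j ω') ∂μ ≤ c) (n : ℕ) :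
    ∫⁻ ω, ∏ j ∈ Finset.range n, φ j ω (X j ω) ∂μ ≤ c ^ n := by
  induction n with
  | zero => simp
  | succ n ih =>
    let W (ω : Ω) : ℝ≥0∞ := ∏ j ∈ Finset.range n, φ j ω (X j ω)
    have hW : Measurable[past X n] W := Finset.measurable_fun_prod _ fun j hj =>
      measurable_past_eval (Finset.mem_range.1 hj) (hφ j)
    have hWφ : Measurable[(past X n).prod inferInstance]
        (Function.uncurry fun ω e => W ω * φ n ω e) :=
      (hW.comp (@measurable_fst _ _ (past X n) _)).mul (hφ n)
    calc ∫⁻ ω, ∏ j ∈ Finset.range (n + 1), φ j ω (X j ω) ∂μ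
        = ∫⁻ ω, W ω * φ n ω (X n ω) ∂μ := by simp only [W, Finset.prod_range_succ]
      _ = ∫⁻ ω, ∫⁻ ω', W ω * φ n ω (X n ω') ∂μ ∂μ :=
        lintegral_past_eq hX hindep hWφ
      _ = ∫⁻ ω, W ω * ∫⁻ ω', φ n ω (X n ω') ∂μ ∂μ := by
        refine lintegral_congr fun ω => lintegral_const_mul _ ?_
        exact (@Measurable.of_uncurry_left _ _ _ (past X n) _ _ _ (hφ n) ω).comp (hX n)
      _ ≤ ∫⁻ ω, W ω * c ∂μ := lintegral_mono fun ω => mul_le_mul_right (hc n ω) _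
      _ = (∫⁻ ω, W ω ∂μ) * c := lintegral_mul_const _ (hW.mono (past_le hX n) le_rfl)
      _ ≤ c ^ (n + 1) := by rw [pow_succ]; exact mul_le_mul_left ih _

lemma lintegral_exp_neg_mul_le [IsProbabilityMeasure μ] {V : Ω → ℝ} (hV : AEMeasurable V μ)
    (hV0 : ∀ ω, 0 ≤ V ω) (hV1 : ∀ ω, V ω ≤ 1) {p s : ℝ} (hp : p ≤ ∫ ω, V ω ∂μ) (hs : 0 ≤ s) :
    ∫⁻ ω, ENNReal.ofReal (Real.exp (-(s * V ω))) ∂μ ≤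
      ENNReal.ofReal (Real.exp (s ^ 2 / 8 - s * p)) := by
  have hoeffding : ∫ ω, Real.exp (-s * (V ω - ∫ ω, V ω ∂μ)) ∂μ ≤ Real.exp (s ^ 2 / 8) := by
    have h := (hasSubgaussianMGF_of_mem_Icc hV (ae_of_all _ fun ω => ⟨hV0 ω, hV1 ω⟩)).mgf_le (-s)
    refine h.trans_eq ?_
    congr 1
    simp
    ring
  have hint : Integrable (fun ω => Real.exp (-(s * V ω))) μ := by
    refine Integrable.of_bound (by fun_prop) 1 (ae_of_all _ fun ω => ?_)
    rw [Real.norm_of_nonneg (Real.exp_pos _).le, Real.exp_le_one_iff, neg_nonpos]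
    exact mul_nonneg hs (hV0 ω)
  rw [← ofReal_integral_eq_lintegral_ofReal hint (ae_of_all _ fun ω => (Real.exp_pos _).le)]
  refine ENNReal.ofReal_le_ofReal ?_
  calc ∫ ω, Real.exp (-(s * V ω)) ∂μ
      = (∫ ω, Real.exp (-s * (V ω - ∫ ω, V ω ∂μ)) ∂μ) * Real.exp (-(s * ∫ ω, V ω ∂μ)) := by
        rw [← integral_mul_const]
        refine integral_congr_ae (ae_of_all _ fun ω => ?_)
        simp only [← Real.exp_add]
        ring_nf
    _ ≤ Real.exp (s ^ 2 / 8) * Real.exp (-(s * p)) := by gcongr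
    _ = Real.exp (s ^ 2 / 8 - s * p) := by rw [← Real.exp_add, sub_eq_add_neg]

lemma measure_sum_le_le_exp [IsProbabilityMeasure μ] {X : ℕ → Ω → E} (hX : ∀ i, Measurable (X i))
    (hindep : iIndepFun X μ) {V : ℕ → Ω → E → ℝ}
    (hV : ∀ j, Measurable[(past X j).prod inferInstance] (Function.uncurry (V j)))
    (hV0 : ∀ j ω e, 0 ≤ V j ω e) (hV1 : ∀ j ω e, V j ω e ≤ 1) {p : ℝ}
    (hp : ∀ j ω, p ≤ ∫ ω', V j ω (X j ω') ∂μ) {n : ℕ} (hn : n ≠ 0) {r : ℝ} (hr : 0 ≤ r) :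
    μ {ω | ∑ j ∈ Finset.range n, V j ω (X j ω) ≤ n * p - r} ≤
      ENNReal.ofReal (Real.exp (-(2 * r ^ 2 / n))) := by
  let s : ℝ := 4 * r / n
  have hs : 0 ≤ s := by positivity
  let S (ω : Ω) : ℝ := ∑ j ∈ Finset.range n, V j ω (X j ω)
  have hS : Measurable S := (Finset.measurable_fun_sum _ fun j hj =>
    measurable_past_eval (Finset.mem_range.1 hj) (hV j)).mono (past_le hX n) le_rfl
  have hmoment : ∫⁻ ω, ENNReal.ofReal (Real.exp (-(s * S ω))) ∂μ ≤
      ENNReal.ofReal (Real.exp (n * (s ^ 2 / 8 - s * p))) := by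
    rw [Real.exp_nat_mul, ENNReal.ofReal_pow (Real.exp_pos _).le]
    simp only [S, Finset.mul_sum, ← Finset.sum_neg_distrib, Real.exp_sum,
      ENNReal.ofReal_prod_of_nonneg fun _ _ => (Real.exp_pos _).le]
    refine lintegral_prod_le_pow hX hindep
      (φ := fun j ω e => ENNReal.ofReal (Real.exp (-(s * V j ω e)))) (fun j => ?_)
      (fun j ω => ?_) n
    · exact ENNReal.measurable_ofReal.comp (Real.measurable_exp.comp ((hV j).const_mul s).neg)
    · have hVX : Measurable fun ω' => V j ω (X j ω') :=
        (@Measurable.of_uncurry_left _ _ _ (past X j) _ _ _ (hV j) ω).comp (hX j)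
      exact lintegral_exp_neg_mul_le hVX.aemeasurable (fun _ => hV0 _ _ _) (fun _ => hV1 _ _ _)
        (hp j ω) hs
  have hsub : {ω | S ω ≤ n * p - r} ⊆ {ω | ENNReal.ofReal (Real.exp (-(s * (n * p - r)))) ≤
      ENNReal.ofReal (Real.exp (-(s * S ω)))} := fun ω hω => ENNReal.ofReal_le_ofReal
    (Real.exp_le_exp.2 (neg_le_neg (mul_le_mul_of_nonneg_left hω hs)))
  have hpos : ENNReal.ofReal (Real.exp (-(s * (n * p - r)))) ≠ 0 := by
    simp [Real.exp_pos]
  calc μ {ω | S ω ≤ n * p - r}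
      ≤ ENNReal.ofReal (Real.exp (n * (s ^ 2 / 8 - s * p))) /
          ENNReal.ofReal (Real.exp (-(s * (n * p - r)))) :=
        (measure_mono hsub).trans <|
          (meas_ge_le_lintegral_div (by fun_prop) hpos ENNReal.ofReal_ne_top).trans
            (ENNReal.div_le_div_right hmoment _)
    _ = ENNReal.ofReal (Real.exp (-(2 * r ^ 2 / n))) := by
        have hn' : (n : ℝ) ≠ 0 := Nat.cast_ne_zero.2 hn
        rw [← ENNReal.ofReal_div_of_pos (Real.exp_pos _), ← Real.exp_sub]
        congr 2
        simp only [s]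
        field_simp
        ring

lemma ae_eventually_of_measure_le {p : ℕ → Ω → Prop} {u : ℕ → ℝ} (hu : Summable u)
    (hp : ∀ᶠ n in atTop, μ {ω | ¬p n ω} ≤ ENNReal.ofReal (u n)) :
    ∀ᵐ ω ∂μ, ∀ᶠ n in atTop, p n ω := by
  obtain ⟨N, hN⟩ := eventually_atTop.1 hp
  have hsum : ∑' n, μ {ω | ¬p (n + N) ω} ≠ ∞ :=
    ne_top_of_le_ne_top ((summable_nat_add_iff N).2 hu).tsum_ofReal_ne_top
      (ENNReal.tsum_le_tsum fun n => hN (n + N) (N.le_add_left n))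
  filter_upwards [ae_eventually_notMem hsum] with ω hω
  obtain ⟨M, hM⟩ := eventually_atTop.1 hω
  refine eventually_atTop.2 ⟨M + N, fun n hn => ?_⟩
  have := hM (n - N) (by omega)
  rw [Nat.sub_add_cancel (by omega)] at this
  exact not_not.1 this

end Probability

/-! ### The sum of the exit values -/

/-- The points other than `z` of `B` occupied after `n` particles. The hitting function of `z` is
harmonic there, so that it is a martingale along a walk until the walk leaves this set. -/
noncomputable def clusterIn (B : Finset (ℤ × ℤ)) (z : ℤ × ℤ) (x : ℕ → ℕ → ℤ × ℤ) (n : ℕ) :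
    Finset (ℤ × ℤ) :=
  open Classical in (B.erase z).filter (· ∈ cluster x n)

lemma mem_clusterIn {B : Finset (ℤ × ℤ)} {z : ℤ × ℤ} {x : ℕ → ℕ → ℤ × ℤ} {n : ℕ} {v : ℤ × ℤ} :
    v ∈ clusterIn B z x n ↔ v ∈ B.erase z ∧ v ∈ cluster x n := by
  simp [clusterIn]

lemma cluster_mono (x : ℕ → ℕ → ℤ × ℤ) : Monotone (cluster x) :=
  monotone_nat_of_le_succ fun _ => Set.subset_union_left

lemma mem_exitPoint_of_subset {A A' : Set (ℤ × ℤ)} (h : A' ⊆ A) {y : ℕ → ℤ × ℤ} {w : ℤ × ℤ}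
    (hw : w ∈ exitPoint A' y) (hwA : w ∉ A) : w ∈ exitPoint A y := by
  obtain ⟨t, rfl, -, ht⟩ := hw
  exact ⟨t, rfl, hwA, fun s hs => h (ht s hs)⟩

lemma sum_exitValue_le {B : Finset (ℤ × ℤ)} {z : ℤ × ℤ} {H : ℤ × ℤ → ℝ} (hH : ∀ w, 0 ≤ H w)
    (x : ℕ → ℕ → ℤ × ℤ) {n : ℕ} (hz : z ∉ cluster x n) :
    ∑ j ∈ Finset.range n, exitValue B H (clusterIn B z x j) (x j) ≤
      ∑ w ∈ B, (cluster x n).indicator H w := by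
  induction n with
  | zero => simp [cluster]
  | succ n ih =>
    have hzn : z ∉ cluster x n := fun h => hz (cluster_mono x n.le_succ h)
    rw [Finset.sum_range_succ]
    refine (add_le_add_left (ih hzn) _).trans ?_
    rw [exitValue, ← Finset.sum_add_distrib]
    refine Finset.sum_le_sum fun w hw => ?_
    by_cases hexit : w ∈ exitPoint (clusterIn B z x n) (x n)
    · have hwD : w ∉ clusterIn B z x n := fun h => by
        obtain ⟨t, rfl, ht, -⟩ := hexit
        exact ht h
      have hwn : w ∉ cluster x n := fun h =>
        hwD (mem_clusterIn.2 ⟨Finset.mem_erase.2 ⟨fun hwz => hzn (hwz ▸ h), hw⟩, h⟩)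
      have hsettles : w ∈ cluster x (n + 1) :=
        Or.inr (mem_exitPoint_of_subset (fun v hv => (mem_clusterIn.1 hv).2) hexit hwn)
      simp [hwn, hexit, hsettles]
    · rw [Set.indicator_of_notMem hexit, add_zero]
      exact Set.indicator_le_indicator_of_subset (cluster_mono x n.le_succ) hH w

section Cluster

variable {Ω : Type*} {ξ : ℕ → Ω → ℕ → ℤ × ℤ}

lemma measurableSet_mem_cluster (n : ℕ) (v : ℤ × ℤ) :
    MeasurableSet[past ξ n] {ω | v ∈ cluster (fun i => ξ i ω) n} := by
  induction n generalizing v with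
  | zero => exact @MeasurableSet.empty Ω (past ξ 0)
  | succ n ih =>
    have hcluster (w : ℤ × ℤ) := past_mono ξ n.le_succ _ (ih w)
    exact (hcluster v).union <|
      @measurableSet_mem_exitPoint Ω (past ξ (n + 1)) _ hcluster _
        (measurable_past ξ n.lt_succ_self) v

lemma measurable_exitValue_clusterIn (B : Finset (ℤ × ℤ)) (z : ℤ × ℤ) (H : ℤ × ℤ → ℝ) (j : ℕ) :
    Measurable[(past ξ j).prod inferInstance]
      (Function.uncurry fun ω y => exitValue B H (clusterIn B z (fun i => ξ i ω) j) y) := by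
  refine @measurable_exitValue _ _ (Ω × (ℕ → ℤ × ℤ)) ((past ξ j).prod inferInstance)
    (fun q => clusterIn B z (fun i => ξ i q.1) j) (fun v => ?_) Prod.snd
    (@measurable_snd _ _ (past ξ j) _)
  simp only [Finset.mem_coe, mem_clusterIn]
  exact (MeasurableSet.const _).inter
    (@measurable_fst _ _ (past ξ j) _ _ (measurableSet_mem_cluster j v))

variable [MeasurableSpace Ω] {μ : Measure Ω} [IsProbabilityMeasure μ]

lemma measure_notMem_cluster_le (hξ : ∀ i, IsSimpleRandomWalk μ fun t ω => ξ i ω t)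
    (hindep : iIndepFun ξ μ) {B : Finset (ℤ × ℤ)} {z : ℤ × ℤ} {H : ℤ × ℤ → ℝ}
    (hH : IsHittingFunction comb B z H) {n : ℕ} (hn : n ≠ 0) {r : ℝ} (hr : 0 ≤ r)
    (hsum : ∑ w ∈ B, H w ≤ n * H (0, 0) - r) :
    μ {ω | z ∉ cluster (fun i => ξ i ω) n} ≤
      ENNReal.ofReal (Real.exp (-(2 * r ^ 2 / n))) := by
  have hnonneg := hH.nonneg comb_preconnected
  have hle_one := hH.le_one comb_preconnected
  have hdrift (j : ℕ) (ω : Ω) : H (0, 0) ≤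
      ∫ ω', exitValue B H (clusterIn B z (fun i => ξ i ω) j) (ξ j ω') ∂μ := by
    refine (hξ j).le_integral_exitValue (fun v hv => ?_) hnonneg
      hH.apply_of_notMem fun v hv => ?_
    all_goals have hv := Finset.mem_erase.1 (mem_clusterIn.1 hv).1
    exacts [hv.2, (hH.laplacian_eq_zero v hv.2 hv.1).ge]
  refine (measure_mono fun ω hω => ?_).trans <|
    measure_sum_le_le_exp (fun i => measurable_pi_lambda _ (hξ i).measurable) hindep
      (measurable_exitValue_clusterIn B z H) (fun _ _ => exitValue_nonneg hnonneg _)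
      (fun _ _ => exitValue_le_one hle_one _) hdrift hn hr
  calc ∑ j ∈ Finset.range n, exitValue B H (clusterIn B z (fun i => ξ i ω) j) (ξ j ω)
      ≤ ∑ w ∈ B, (cluster (fun i => ξ i ω) n).indicator H w := sum_exitValue_le hnonneg _ hω
    _ ≤ ∑ w ∈ B, H w := Finset.sum_le_sum fun w _ => Set.indicator_le_self' (fun w _ => hnonneg w) w
    _ ≤ n * H (0, 0) - r := hsum

end Cluster

/-! ### The odometer -/

/-- The triangular number `t (t + 1) / 2`, extended by `0` to negative `t`. -/
noncomputable def tri (t : ℝ) : ℝ := max t 0 * (max t 0 + 1) / 2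

lemma tri_of_nonneg {t : ℝ} (ht : 0 ≤ t) : tri t = t * (t + 1) / 2 := by rw [tri, max_eq_left ht]

lemma tri_of_nonpos {t : ℝ} (ht : t ≤ 0) : tri t = 0 := by simp [tri, ht]

lemma tri_nonneg (t : ℝ) : 0 ≤ tri t := by
  unfold tri
  positivity

lemma le_tri {t : ℝ} (ht : -1 ≤ t) : t * (t + 1) / 2 ≤ tri t := by
  obtain h | h := le_total 0 t
  · exact (tri_of_nonneg h).ge
  · rw [tri_of_nonpos h]
    nlinarith

lemma one_le_tri_add_tri_sub {t : ℝ} (ht : 0 ≤ t) : 1 ≤ tri (t + 1) + tri (t - 1) - 2 * tri t := by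
  have := le_tri (t := t - 1) (by linarith)
  rw [tri_of_nonneg (add_nonneg ht zero_le_one), tri_of_nonneg ht]
  linarith

/-- The half-length `m (m + 3) / 3`, with `m = M - |x|`, of the tooth over `x` in `region M`; it is
`0` for `M ≤ |x|`. The quadratic is chosen so that the flow along the axis feeds the teeth, see
`axis_second_difference`. -/
noncomputable def toothLength (M : ℕ) (x : ℤ) : ℝ :=
  max ((M : ℝ) - |(x : ℝ)|) 0 * (max ((M : ℝ) - |(x : ℝ)|) 0 + 3) / 3

/-- The distance from `v` to the end of its tooth, nonpositive outside `region M`. -/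
noncomputable def gap (M : ℕ) (v : ℤ × ℤ) : ℝ := toothLength M v.1 - |(v.2 : ℝ)|

/-- An approximation from below of the odometer function of the divisible sandpile: the mass which
`v` sends along each of its edges while a pile at the origin spreads over `region M`. -/
noncomputable def odometer (M : ℕ) (v : ℤ × ℤ) : ℝ := tri (gap M v)

/-- The finite set filled by the sandpile, a discrete version of the limit shape; the box only
serves to make it a `Finset`, see `mem_region`. -/
noncomputable def region (M : ℕ) : Finset (ℤ × ℤ) :=
  (Finset.Icc (-(M : ℤ)) M ×ˢ Finset.Icc (-(M ^ 2 + M : ℤ)) (M ^ 2 + M)).filter (0 < gap M ·)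

section Odometer

variable {M : ℕ}

lemma toothLength_nonneg (M : ℕ) (x : ℤ) : 0 ≤ toothLength M x := by
  unfold toothLength
  positivity

lemma toothLength_of_le {x : ℤ} (h : |(x : ℝ)| ≤ M) :
    toothLength M x = (M - |(x : ℝ)|) * (M - |(x : ℝ)| + 3) / 3 := by
  rw [toothLength, max_eq_left (sub_nonneg.2 h)]

lemma toothLength_of_ge {x : ℤ} (h : M ≤ |(x : ℝ)|) : toothLength M x = 0 := by
  rw [toothLength, max_eq_right (sub_nonpos.2 h), zero_mul, zero_div]

lemma abs_fst_lt_of_gap_pos {v : ℤ × ℤ} (h : 0 < gap M v) : |v.1| < M := by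
  by_contra! hle
  have hzero := toothLength_of_ge (x := v.1) (M := M) (by exact_mod_cast hle)
  rw [gap, hzero] at h
  linarith [abs_nonneg (v.2 : ℝ)]

lemma abs_snd_lt_of_gap_pos {v : ℤ × ℤ} (h : 0 < gap M v) : |v.2| < M ^ 2 + M := by
  have hx : |(v.1 : ℝ)| < M := by exact_mod_cast abs_fst_lt_of_gap_pos h
  rw [gap, toothLength_of_le hx.le] at h
  have : |(v.2 : ℝ)| < M ^ 2 + M := by nlinarith [abs_nonneg (v.1 : ℝ)]
  exact_mod_cast this

lemma mem_region {v : ℤ × ℤ} : v ∈ region M ↔ 0 < gap M v := by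
  refine ⟨fun h => (Finset.mem_filter.1 h).2, fun h => Finset.mem_filter.2 ⟨?_, h⟩⟩
  have hfst := abs_lt.1 (abs_fst_lt_of_gap_pos h)
  have hsnd := abs_lt.1 (abs_snd_lt_of_gap_pos h)
  exact Finset.mem_product.2 ⟨Finset.mem_Icc.2 ⟨hfst.1.le, hfst.2.le⟩,
    Finset.mem_Icc.2 ⟨hsnd.1.le, hsnd.2.le⟩⟩

lemma card_region_le (hM : M ≠ 0) : (region M).card ≤ 15 * M ^ 3 := by
  have hM' : 1 ≤ M := Nat.one_le_iff_ne_zero.2 hM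
  calc (region M).card
      ≤ ((M : ℤ) + 1 - -M).toNat * ((M ^ 2 + M : ℤ) + 1 - -(M ^ 2 + M : ℤ)).toNat := by
        rw [← Int.card_Icc, ← Int.card_Icc, ← Finset.card_product]
        exact Finset.card_filter_le _ _
    _ = (2 * M + 1) * (2 * (M ^ 2 + M) + 1) := by
        congr 1
        · omega
        · zify
          rw [Int.toNat_of_nonneg (by linarith [sq_nonneg (M : ℤ)])]
          ring
    _ ≤ (3 * M) * (5 * M ^ 2) := by gcongr <;> nlinarith
    _ = 15 * M ^ 3 := by ring

lemma odometer_of_notMem {v : ℤ × ℤ} (h : v ∉ region M) : odometer M v = 0 :=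
  tri_of_nonpos (not_lt.1 (mem_region.not.1 h))

lemma apply_abs_add_apply_abs {x : ℤ} (hx : x ≠ 0) (f : ℝ → ℝ) :
    f |((x + 1 : ℤ) : ℝ)| + f |((x - 1 : ℤ) : ℝ)| = f (|(x : ℝ)| + 1) + f (|(x : ℝ)| - 1) := by
  push_cast
  obtain h | h := lt_or_gt_of_ne hx
  · have h' : (x : ℝ) ≤ -1 := by exact_mod_cast Int.le_sub_one_of_lt h
    rw [abs_of_nonpos (a := (x : ℝ) + 1) (by linarith), abs_of_nonpos (a := (x : ℝ)) (by linarith),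
      abs_of_nonpos (a := (x : ℝ) - 1) (by linarith), add_comm]
    ring_nf
  · have h' : (1 : ℝ) ≤ x := by exact_mod_cast h
    rw [abs_of_nonneg (a := (x : ℝ) + 1) (by linarith), abs_of_nonneg (a := (x : ℝ)) (by linarith),
      abs_of_nonneg (a := (x : ℝ) - 1) (by linarith)]

lemma laplacian_odometer_vertical_ge (M : ℕ) (x : ℤ) : -(2 * toothLength M x) ≤
    odometer M (x, 0 + 1) + odometer M (x, 0 - 1) - 2 * odometer M (x, 0) := by
  have hL := toothLength_nonneg M x
  have hle := le_tri (t := toothLength M x - 1) (by linarith)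
  simp only [odometer, gap, zero_add, zero_sub, Int.cast_neg, Int.cast_one, Int.cast_zero, abs_neg,
    abs_one, abs_zero, sub_zero, tri_of_nonneg hL]
  linarith

/-- On the axis the odometer is a polynomial in the distance `m = M - |x|`. -/
noncomputable def axisProfile (m : ℝ) : ℝ := m * (m + 3) * (m ^ 2 + 3 * m + 3) / 18

lemma odometer_axis {x : ℤ} (hx : |(x : ℝ)| ≤ M) :
    odometer M (x, 0) = axisProfile (M - |(x : ℝ)|) := by
  rw [odometer, gap, Int.cast_zero, abs_zero, sub_zero, tri_of_nonneg (toothLength_nonneg M x),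
    toothLength_of_le hx, axisProfile]
  ring

lemma axis_second_difference (m : ℝ) : axisProfile (m + 1) + axisProfile (m - 1) -
    2 * axisProfile m = 2 * (m * (m + 3) / 3) + 13 / 9 := by
  unfold axisProfile
  ring

lemma one_le_laplacian_odometer_axis {x : ℤ} (hx : |x| < M) (hx0 : x ≠ 0) :
    1 ≤ laplacian comb (odometer M) (x, 0) := by
  have hxM : |(x : ℝ)| + 1 ≤ M := by exact_mod_cast hx
  have hneighbor (s : ℤ) (hs : |(s : ℝ)| = 1) : |((x + s : ℤ) : ℝ)| ≤ M := by
    push_cast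
    linarith [abs_add_le (x : ℝ) s]
  have hvertical := laplacian_odometer_vertical_ge M x
  rw [toothLength_of_le (by linarith)] at hvertical
  have hfold := apply_abs_add_apply_abs hx0 fun t => axisProfile (M - t)
  have hdiff := axis_second_difference (M - |(x : ℝ)|)
  rw [laplacian_comb, if_pos rfl, odometer_axis (x := x + 1) (hneighbor 1 (by simp)),
    odometer_axis (x := x - 1) (hneighbor (-1) (by simp)), hfold]
  rw [odometer_axis (x := x) (by linarith)] at hvertical ⊢
  rw [sub_add_eq_sub_sub, ← sub_add]
  linear_combination hvertical - hdiff

lemma one_le_laplacian_odometer_tooth {x y : ℤ} (hg : 0 < gap M (x, y)) (hy : y ≠ 0) :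
    1 ≤ laplacian comb (odometer M) (x, y) := by
  have hfold := apply_abs_add_apply_abs hy fun t => tri (toothLength M x - t)
  have hconvex := one_le_tri_add_tri_sub hg.le
  simp only [gap] at hconvex
  rw [laplacian_comb, if_neg hy, add_zero]
  simp only [odometer, gap, hfold]
  rw [sub_add_eq_sub_sub, ← sub_add]
  linarith

lemma one_le_laplacian_odometer {v : ℤ × ℤ} (hv : v ∈ region M) (h0 : v ≠ (0, 0)) :
    1 ≤ laplacian comb (odometer M) v := by
  obtain ⟨x, y⟩ := v
  have hg := mem_region.1 hv
  obtain rfl | hy := eq_or_ne y 0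
  · exact one_le_laplacian_odometer_axis (abs_fst_lt_of_gap_pos hg) fun hx => h0 (hx ▸ rfl)
  · exact one_le_laplacian_odometer_tooth hg hy

lemma laplacian_odometer_origin_ge (hM : M ≠ 0) :
    -(4 / 9 * (M : ℝ) ^ 3 + 6 * (M : ℝ) ^ 2) ≤ laplacian comb (odometer M) (0, 0) := by
  have hM' : (1 : ℝ) ≤ M := by exact_mod_cast Nat.one_le_iff_ne_zero.2 hM
  have hvertical := laplacian_odometer_vertical_ge M 0
  rw [toothLength_of_le (by simp)] at hvertical
  rw [laplacian_comb, if_pos rfl, odometer_axis (x := 0 + 1) (by simpa using hM'),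
    odometer_axis (x := 0 - 1) (by simpa using hM')]
  rw [odometer_axis (by simp)] at hvertical ⊢
  simp only [zero_add, zero_sub, Int.cast_neg, Int.cast_one, Int.cast_zero, abs_neg, abs_one,
    abs_zero, sub_zero, axisProfile] at hvertical ⊢
  nlinarith

lemma IsHittingFunction.one_le_mul_neg_laplacian_self {z : ℤ × ℤ} {H : ℤ × ℤ → ℝ}
    (hH : IsHittingFunction comb (region M) z H) :
    1 ≤ 2 * ((M : ℝ) ^ 2 + M) * -laplacian comb H z := by
  obtain ⟨x, y⟩ := z
  obtain ⟨p, hp⟩ := exists_vertical_walk x y (2 * (M ^ 2 + M))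
  have hend : (x, y + (2 * (M ^ 2 + M) : ℕ)) ∉ region M := fun h => by
    have hy := abs_lt.1 (abs_snd_lt_of_gap_pos (mem_region.1 hH.mem))
    have hy' := abs_lt.1 (abs_snd_lt_of_gap_pos (mem_region.1 h))
    push_cast at hy'
    linarith
  have hwalk := hH.sub_le_length_mul comb_preconnected p
  rw [hH.apply_self, hH.apply_of_notMem _ hend, hp, sub_zero] at hwalk
  exact_mod_cast hwalk

lemma IsHittingFunction.sum_le (hM : M ≠ 0) {n : ℕ}
    (hn : 4 / 9 * (M : ℝ) ^ 3 + 7 * (M : ℝ) ^ 2 ≤ n) {z : ℤ × ℤ} {H : ℤ × ℤ → ℝ}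
    (hH : IsHittingFunction comb (region M) z H) :
    ∑ w ∈ region M, H w ≤ n * H (0, 0) - odometer M z / (2 * ((M : ℝ) ^ 2 + M)) := by
  have hM' : (1 : ℝ) ≤ M := by exact_mod_cast Nat.one_le_iff_ne_zero.2 hM
  have hH0 := hH.nonneg comb_preconnected
  have horigin : ((0, 0) : ℤ × ℤ) ∈ region M := by
    rw [mem_region, gap, toothLength_of_le (by simp)]
    simp only [Int.cast_zero, abs_zero, sub_zero]
    positivity
  have hgreen : ∑ v ∈ region M, H v * laplacian comb (odometer M) v =
      odometer M z * laplacian comb H z := by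
    rw [sum_mul_laplacian_comm hH.apply_of_notMem fun v => odometer_of_notMem]
    exact Finset.sum_eq_single_of_mem z hH.mem fun v hv hvz => by
      rw [hH.laplacian_eq_zero v hv hvz, mul_zero]
  have hodometer : 0 ≤ odometer M z := tri_nonneg _
  have hflow : odometer M z / (2 * ((M : ℝ) ^ 2 + M)) ≤ -(odometer M z * laplacian comb H z) := by
    rw [div_le_iff₀ (by positivity)]
    linarith [mul_le_mul_of_nonneg_left hH.one_le_mul_neg_laplacian_self hodometer]
  have hlower : ∑ v ∈ region M, H v * (1 - if v = (0, 0) then (n : ℝ) else 0) ≤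
      ∑ v ∈ region M, H v * laplacian comb (odometer M) v := by
    refine Finset.sum_le_sum fun v hv => mul_le_mul_of_nonneg_left ?_ (hH0 v)
    split_ifs with hv0
    · rw [hv0]
      nlinarith [laplacian_odometer_origin_ge hM]
    · simpa using one_le_laplacian_odometer hv hv0
  have hsum : ∑ v ∈ region M, H v * (1 - if v = (0, 0) then (n : ℝ) else 0) =
      ∑ v ∈ region M, H v - n * H (0, 0) := by
    simp only [mul_sub, mul_one, Finset.sum_sub_distrib, mul_ite, mul_zero, Finset.sum_ite_eq',
      if_pos horigin, mul_comm]
  linarith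

end Odometer

/-! ### The limit shape -/

lemma sq_div_three_le_gap {M : ℕ} {t : ℝ} (ht : 0 ≤ t) {z : ℤ × ℤ}
    (hz : |(z.1 : ℝ)| + √(3 * |(z.2 : ℝ)|) + t ≤ M) : t ^ 2 / 3 ≤ gap M z := by
  have hsqrt := Real.sqrt_nonneg (3 * |(z.2 : ℝ)|)
  have hsq := Real.sq_sqrt (show 0 ≤ 3 * |(z.2 : ℝ)| by positivity)
  rw [gap, toothLength_of_le (by linarith)]
  nlinarith

lemma pow_four_div_le_odometer {M : ℕ} {t : ℝ} (ht : 0 ≤ t) {z : ℤ × ℤ}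
    (hz : |(z.1 : ℝ)| + √(3 * |(z.2 : ℝ)|) + t ≤ M) : t ^ 4 / 18 ≤ odometer M z := by
  have hgap := sq_div_three_le_gap ht hz
  have hgap0 : 0 ≤ gap M z := le_trans (by positivity) hgap
  calc t ^ 4 / 18 = t ^ 2 / 3 * (t ^ 2 / 3) / 2 := by ring
    _ ≤ gap M z * (gap M z + 1) / 2 := by gcongr; linarith
    _ = odometer M z := (tri_of_nonneg hgap0).symm

section Cluster

variable {Ω : Type*} [MeasurableSpace Ω] {μ : Measure Ω} [IsProbabilityMeasure μ]
  {ξ : ℕ → Ω → ℕ → ℤ × ℤ}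

lemma measure_notMem_cluster_le_exp (hξ : ∀ i, IsSimpleRandomWalk μ fun t ω => ξ i ω t)
    (hindep : iIndepFun ξ μ) {n M : ℕ} (hM : M ≠ 0) {R η : ℝ} (hη : 0 < η) (hMR : M ≤ R)
    (hR : 4 / 9 * R ^ 3 = n) (hn : 4 / 9 * (M : ℝ) ^ 3 + 7 * (M : ℝ) ^ 2 ≤ n) {z : ℤ × ℤ}
    (hz : |(z.1 : ℝ)| + √(3 * |(z.2 : ℝ)|) + η * R ≤ M) :
    μ {ω | z ∉ cluster (fun i => ξ i ω) n} ≤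
      ENNReal.ofReal (Real.exp (-(η ^ 8 / 1152 * R))) := by
  have hM1 : (1 : ℝ) ≤ M := by exact_mod_cast Nat.one_le_iff_ne_zero.2 hM
  have hR0 : 0 < R := by linarith
  have hn0 : (0 : ℝ) < n := hR ▸ by positivity
  have hzM : z ∈ region M :=
    mem_region.2 (lt_of_lt_of_le (by positivity) (sq_div_three_le_gap (by positivity) hz))
  obtain ⟨H, hH⟩ := exists_isHittingFunction comb_preconnected hzM
  let r := odometer M z / (2 * ((M : ℝ) ^ 2 + M))
  have hr : η ^ 4 * R ^ 2 / 72 ≤ r := by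
    calc η ^ 4 * R ^ 2 / 72 = (η * R) ^ 4 / 18 / (2 * (R ^ 2 + R ^ 2)) := by field_simp; ring
      _ ≤ odometer M z / (2 * ((M : ℝ) ^ 2 + M)) := by
        have hodometer := pow_four_div_le_odometer (by positivity) hz
        have : (M : ℝ) ≤ R ^ 2 := by nlinarith
        gcongr
        exact tri_nonneg _
  have hr0 : 0 ≤ r := le_trans (by positivity) hr
  refine (measure_notMem_cluster_le hξ hindep hH (Nat.cast_pos.1 hn0).ne' hr0
    (hH.sum_le hM hn)).trans (ENNReal.ofReal_le_ofReal (Real.exp_le_exp.2 (neg_le_neg ?_)))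
  calc η ^ 8 / 1152 * R = 2 * (η ^ 4 * R ^ 2 / 72) ^ 2 / n := by rw [← hR]; field_simp; ring
    _ ≤ 2 * r ^ 2 / n := by gcongr

lemma measure_not_subset_cluster_le (hξ : ∀ i, IsSimpleRandomWalk μ fun t ω => ξ i ω t)
    (hindep : iIndepFun ξ μ) {n M : ℕ} (hM : M ≠ 0) {R η : ℝ} (hη : 0 < η) (hMR : M ≤ R)
    (hR : 4 / 9 * R ^ 3 = n) (hn : 4 / 9 * (M : ℝ) ^ 3 + 7 * (M : ℝ) ^ 2 ≤ n)
    {S : Set (ℤ × ℤ)} (hS : ∀ z ∈ S, |(z.1 : ℝ)| + √(3 * |(z.2 : ℝ)|) + η * R ≤ M) :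
    μ {ω | ¬ S ⊆ cluster (fun i => ξ i ω) n} ≤
      ENNReal.ofReal (15 * R ^ 3 * Real.exp (-(η ^ 8 / 1152 * R))) := by
  classical
  have hR0 : 0 < R := lt_of_lt_of_le (by positivity) hMR
  let T := (region M).filter (· ∈ S)
  have hST (z : ℤ × ℤ) (hz : z ∈ S) : z ∈ T := by
    refine Finset.mem_filter.2 ⟨mem_region.2 ?_, hz⟩
    exact lt_of_lt_of_le (by positivity) (sq_div_three_le_gap (by positivity) (hS z hz))
  have hcard : (T.card : ℝ) ≤ 15 * R ^ 3 := by
    calc (T.card : ℝ) ≤ 15 * (M : ℝ) ^ 3 := by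
          exact_mod_cast (Finset.card_filter_le _ _).trans (card_region_le hM)
      _ ≤ 15 * R ^ 3 := by gcongr
  have hcover : {ω | ¬ S ⊆ cluster (fun i => ξ i ω) n} ⊆
      ⋃ z ∈ T, {ω | z ∉ cluster (fun i => ξ i ω) n} := fun ω hω => by
    obtain ⟨z, hz, hzc⟩ := Set.not_subset.1 hω
    exact Set.mem_biUnion (hST z hz) hzc
  calc μ {ω | ¬ S ⊆ cluster (fun i => ξ i ω) n}
      ≤ ∑ z ∈ T, μ {ω | z ∉ cluster (fun i => ξ i ω) n} :=
        (measure_mono hcover).trans (measure_biUnion_finset_le _ _)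
    _ ≤ T.card • ENNReal.ofReal (Real.exp (-(η ^ 8 / 1152 * R))) :=
        Finset.sum_le_card_nsmul _ _ _ fun z hz => measure_notMem_cluster_le_exp hξ hindep hM hη
          hMR hR hn (hS z (Finset.mem_filter.1 hz).2)
    _ ≤ ENNReal.ofReal (15 * R ^ 3 * Real.exp (-(η ^ 8 / 1152 * R))) := by
        rw [← ENNReal.ofReal_nsmul, nsmul_eq_mul]
        gcongr

end Cluster

lemma eventually_exp_neg_le {c : ℝ} (hc : 0 < c) (m : ℕ) :
    ∀ᶠ R : ℝ in atTop, Real.exp (-(c * R)) ≤ 1 / R ^ m := by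
  have hlim : Tendsto (fun R : ℝ => (c * R) ^ m * Real.exp (-(c * R))) atTop (nhds 0) :=
    (Real.tendsto_pow_mul_exp_neg_atTop_nhds_zero m).comp (tendsto_id.const_mul_atTop hc)
  filter_upwards [hlim.eventually_le_const (pow_pos hc m), eventually_gt_atTop 0] with R hR hR0
  rw [le_div_iff₀ (by positivity), mul_comm]
  rw [mul_pow, mul_assoc] at hR
  exact le_of_mul_le_mul_left (hR.trans_eq (mul_one _).symm) (by positivity)

lemma exists_eventually_width {α : ℝ} (hα0 : 0 ≤ α) (hα1 : α < 1) :
    ∃ η > 0, ∀ᶠ R : ℝ in atTop, ∃ M : ℕ, M ≠ 0 ∧ M ≤ R ∧ (α + η) * R ≤ M ∧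
      4 / 9 * (M : ℝ) ^ 3 + 7 * (M : ℝ) ^ 2 ≤ 4 / 9 * R ^ 3 := by
  obtain ⟨η, hη0, hη⟩ : ∃ η > 0, α + 3 * η < 1 := ⟨(1 - α) / 6, by linarith, by linarith⟩
  let β := α + 2 * η
  have hβ0 : 0 < β := by positivity
  have hβ1 : β < 1 := by simp only [β]; linarith
  have hβ3 : 0 < 4 / 9 * (1 - β ^ 3) := by
    linarith [pow_lt_one₀ hβ0.le hβ1 (n := 3) (by norm_num)]
  refine ⟨η, hη0, ?_⟩
  filter_upwards [eventually_ge_atTop (1 / η), eventually_ge_atTop (1 / β),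
    eventually_ge_atTop (7 / (4 / 9 * (1 - β ^ 3))), eventually_gt_atTop 0] with R h1 h2 h3 hR0
  rw [div_le_iff₀' hη0] at h1
  rw [div_le_iff₀' hβ0] at h2
  rw [div_le_iff₀ hβ3] at h3
  have hle : (⌊β * R⌋₊ : ℝ) ≤ β * R := Nat.floor_le (by positivity)
  have hleR : (⌊β * R⌋₊ : ℝ) ≤ R := hle.trans (mul_le_of_le_one_left hR0.le hβ1.le)
  refine ⟨⌊β * R⌋₊, (Nat.floor_pos.2 h2).ne', hleR, ?_, ?_⟩
  · have := Nat.sub_one_lt_floor (β * R)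
    simp only [β] at this ⊢
    linarith
  · calc 4 / 9 * (⌊β * R⌋₊ : ℝ) ^ 3 + 7 * (⌊β * R⌋₊ : ℝ) ^ 2
        ≤ 4 / 9 * (β * R) ^ 3 + R * (4 / 9 * (1 - β ^ 3)) * R ^ 2 := by gcongr
      _ = 4 / 9 * R ^ 3 := by ring

lemma k_pos : 0 < k := by unfold k; positivity

lemma l_pos : 0 < l := by unfold l; positivity

lemma k_pow_three : k ^ 3 = 9 / 4 := by
  rw [k, ← Real.rpow_mul_natCast (by norm_num)]
  norm_num

lemma k_sq : k ^ 2 = 3 * l := by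
  have hrpow : ((3 / 2 : ℝ) ^ (2 / 3 : ℝ)) ^ 2 = (3 / 2 : ℝ) ^ (1 / 3 : ℝ) * (3 / 2) := by
    rw [← Real.rpow_mul_natCast (by norm_num), ← Real.rpow_add_one (by norm_num)]
    norm_num
  rw [k, l, hrpow]
  ring

lemma ball_mono : Monotone ball := fun _ _ h _ hz =>
  ⟨hz.1.trans h, hz.2.trans (Real.rpow_le_rpow hz.1 h (by norm_num))⟩

lemma abs_add_sqrt_le_of_mem_ball {r : ℝ} {z : ℤ × ℤ} (hz : z ∈ ball r) :
    |(z.1 : ℝ)| + √(3 * |(z.2 : ℝ)|) ≤ k * r ^ (1 / 3 : ℝ) := by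
  have hl := l_pos.ne'
  calc |(z.1 : ℝ)| + √(3 * |(z.2 : ℝ)|)
      = k * (|(z.1 : ℝ)| / k + (|(z.2 : ℝ)| / l) ^ (1 / 2 : ℝ)) := by
        have hroot : k * √(|(z.2 : ℝ)| / l) = √(k ^ 2 * (|(z.2 : ℝ)| / l)) := by
          rw [Real.sqrt_mul (sq_nonneg k), Real.sqrt_sq k_pos.le]
        rw [mul_add, mul_div_cancel₀ _ k_pos.ne', ← Real.sqrt_eq_rpow, hroot, k_sq]
        field_simp
    _ ≤ k * r ^ (1 / 3 : ℝ) := mul_le_mul_of_nonneg_left hz.2 k_pos.le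

/-- The half-width `k n ^ (1 / 3)` of `ball n`. -/
noncomputable def radius (n : ℕ) : ℝ := k * (n : ℝ) ^ (1 / 3 : ℝ)

lemma radius_pow_three (n : ℕ) : 4 / 9 * radius n ^ 3 = n := by
  rw [radius, mul_pow, k_pow_three, ← Real.rpow_mul_natCast n.cast_nonneg]
  norm_num
  ring

lemma tendsto_radius : Tendsto radius atTop atTop :=
  ((tendsto_rpow_atTop (by norm_num)).comp tendsto_natCast_atTop_atTop).const_mul_atTop k_pos

lemma abs_add_sqrt_le_mul_radius {n : ℕ} {s : ℝ} (hs : 0 ≤ s) {z : ℤ × ℤ}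
    (hz : z ∈ ball (n * s)) :
    |(z.1 : ℝ)| + √(3 * |(z.2 : ℝ)|) ≤ s ^ (1 / 3 : ℝ) * radius n := by
  refine (abs_add_sqrt_le_of_mem_ball hz).trans_eq ?_
  rw [Real.mul_rpow n.cast_nonneg hs, radius]
  ring

lemma eventually_measure_not_ball_subset_le {Ω : Type*} [MeasurableSpace Ω] {μ : Measure Ω}
    [IsProbabilityMeasure μ] {ξ : ℕ → Ω → ℕ → ℤ × ℤ}
    (hξ : ∀ i, IsSimpleRandomWalk μ fun t ω => ξ i ω t) (hindep : iIndepFun ξ μ) {s : ℝ}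
    (hs0 : 0 ≤ s) (hs1 : s < 1) :
    ∀ᶠ n : ℕ in atTop, μ {ω | ¬ ball (n * s) ⊆ cluster (fun i => ξ i ω) n} ≤
      ENNReal.ofReal (15 * (1 / (n : ℝ) ^ 2)) := by
  obtain ⟨η, hη, hwidth⟩ := exists_eventually_width (Real.rpow_nonneg hs0 (1 / 3))
    (Real.rpow_lt_one hs0 hs1 (by norm_num))
  have hexp := eventually_exp_neg_le (c := η ^ 8 / 1152) (by positivity) 9
  filter_upwards [tendsto_radius.eventually hwidth, tendsto_radius.eventually hexp,
    tendsto_radius.eventually_gt_atTop 0, eventually_gt_atTop 0]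
    with n ⟨M, hM, hMR, hMge, hMn⟩ hexpn hR0 hn0
  rw [radius_pow_three] at hMn
  have hball (z : ℤ × ℤ) (hz : z ∈ ball (n * s)) :
      |(z.1 : ℝ)| + √(3 * |(z.2 : ℝ)|) + η * radius n ≤ M := by
    linarith [abs_add_sqrt_le_mul_radius hs0 hz]
  refine (measure_not_subset_cluster_le hξ hindep hM hη hMR (radius_pow_three n) hMn hball).trans
    (ENNReal.ofReal_le_ofReal ?_)
  calc 15 * radius n ^ 3 * Real.exp (-(η ^ 8 / 1152 * radius n))
      ≤ 15 * radius n ^ 3 * (1 / radius n ^ 9) := by gcongr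
    _ = 15 * (1 / (radius n ^ 3) ^ 2) := by field_simp
    _ ≤ 15 * (1 / (n : ℝ) ^ 2) := by
      have : (n : ℝ) ≤ radius n ^ 3 := by
        linarith [radius_pow_three n, pow_pos hR0 3]
      gcongr

lemma ae_eventually_ball_subset {Ω : Type*} [MeasurableSpace Ω] {μ : Measure Ω}
    [IsProbabilityMeasure μ] {ξ : ℕ → Ω → ℕ → ℤ × ℤ}
    (hξ : ∀ i, IsSimpleRandomWalk μ fun t ω => ξ i ω t) (hindep : iIndepFun ξ μ) {s : ℝ}
    (hs0 : 0 ≤ s) (hs1 : s < 1) :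
    ∀ᵐ ω ∂μ, ∀ᶠ n : ℕ in atTop, ball (n * s) ⊆ cluster (fun i => ξ i ω) n :=
  ae_eventually_of_measure_le
    ((Real.summable_one_div_nat_pow.2 one_lt_two).mul_left 15)
    (eventually_measure_not_ball_subset_le hξ hindep hs0 hs1)

end CombIDLA

theorem theorem4p2 {Ω : Type*} [MeasurableSpace Ω] (μ : Measure Ω) [IsProbabilityMeasure μ]
    (X : ℕ → ℕ → Ω → ℤ × ℤ)
    (hX : ∀ i, CombIDLA.IsSimpleRandomWalk μ (X i))
    (hindep : iIndepFun (fun i ω t => X i t ω) μ)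
    (ε : ℝ) (hε : 0 < ε) :
    ∀ᵐ ω ∂μ, ∀ᶠ n : ℕ in atTop,
      CombIDLA.ball ((n : ℝ) * (1 - ε)) ⊆ CombIDLA.cluster (fun i t => X i t ω) n := by
  have hball := CombIDLA.ae_eventually_ball_subset hX hindep (le_max_right (1 - ε) 0)
    (max_lt (sub_lt_self 1 hε) one_pos)
  filter_upwards [hball] with ω hω
  filter_upwards [hω] with n hn
  have hle : n * (1 - ε) ≤ n * max (1 - ε) 0 :=
    mul_le_mul_of_nonneg_left (le_max_left _ _) n.cast_nonneg
  exact (CombIDLA.ball_mono hle).trans hn
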